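/- Let $H$ be a real Hilbert space with unit sphere $S(H)$, let $f\colon H\to\mathbb{R}$ be a Lipschitz function with smallest Lipschitz constant $\mathrm{Lip}(f)$, and let $(x,e)\in H\times S(H)$. For $y\in H$ and $v\in S(H)$ write $f'(y,v)=\lim_{t\to0}\frac{f(y+tv)-f(y)}{t}$ for the (two-sided) directional derivative, when this limit exists, and write $[a,b]$ for the closed line segment between $a,b\in H$. Suppose that $f'(x,e)$ exists and is non-negative, and that there is a family of sets $\{F_\varepsilon\subseteq H\mid\varepsilon>0\}$ such that 1. whenever $\varepsilon,\eta>0$ there exists $\delta_*=\delta_*(\varepsilon,\eta)>0$ such that for any $\delta\in(0,\delta_*)$ and any $u_1,u_2,u_3$ in the closed unit ball of $H$ one can find $u_1',u_2',u_3'\in H$ with $\|u_m'-u_m\|\le\eta$ for $m=1,2,3$ and $$[x+\delta u_1',x+\delta u_3']\cup[x+\delta u_3',x+\delta u_2']\subseteq F_\varepsilon;$$ 2. for every $\varepsilon>0$, whenever $(x',e')\in F_\varepsilon\times S(H)$ is such that the directional derivative $f'(x',e')$ exists, $f'(x',e')\ge f'(x,e)$, and $$|(f(x'+te)-f(x'))-(f(x+te)-f(x))|\le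 25\sqrt{(f'(x',e')-f'(x,e))\,\mathrm{Lip}(f)}\,|t|\quad\text{for every }t\in\mathbb{R},$$ then $f'(x',e')<f'(x,e)+\varepsilon$. Then $f$ is Fréchet differentiable at $x$ and its derivative is given by $f'(x)(h)=f'(x,e)\langle h,e\rangle$ for all $h\in H$. -/

import Mathlib

open scoped NNReal RealInnerProductSpace

/-- `Lip(f)`: the smallest Lipschitz constant of `f` (for Lipschitz `f`). -/
noncomputable def lipConst {X Y : Type*} [PseudoEMetricSpace X] [PseudoEMetricSpace Y]
    (f : X → Y) : ℝ≥0 :=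
  sInf {K : ℝ≥0 | LipschitzWith K f}

/-- For a Lipschitz function, `lipConst f` really is the least Lipschitz constant. -/
theorem isLeast_lipConst {X Y : Type*} [PseudoMetricSpace X] [PseudoMetricSpace Y]
    {f : X → Y} (hf : ∃ K : ℝ≥0, LipschitzWith K f) :
    IsLeast {K : ℝ≥0 | LipschitzWith K f} (lipConst f) := by
  have hclosed : IsClosed {K : ℝ≥0 | LipschitzWith K f} := by
    have h : {K : ℝ≥0 | LipschitzWith K f} =
        ⋂ x, ⋂ y, {K : ℝ≥0 | dist (f x) (f y) ≤ K * dist x y} := by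
      ext K
      simp [lipschitzWith_iff_dist_le_mul]
    rw [h]
    exact isClosed_iInter fun x => isClosed_iInter fun y =>
      isClosed_le continuous_const (by fun_prop)
  exact hclosed.isLeast_csInf hf (OrderBot.bddBelow _)

/-! The argument is by contradiction. Write `D = f'(x, e)`, `L = Lip(f)`, and suppose that the
increment of `f` from `x` to a nearby `x + y` misses `D * ⟪y, e⟫` by more than a multiple of `L * q
* ‖y‖`, with `q` small. Put `s = ‖y‖ / q` and go from about `x - s • e` to about `x + s • e` through
about `x + y`; hypothesis 1 provides such a broken line inside `F ε`. Along it, `h t = f (g t) - D *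
t` is nearly `f x` at both ends, since `f` has derivative `D` along `e`, but is off by a multiple of
`L * q ^ 2 * s` at the kink. Whatever the sign of the deviation, `h` must rise somewhere with slope
of order `L * q ^ 2`.

A detour of relative height `q` changes direction by `O(q)`, but by Pythagoras it stretches length
only by `O(q ^ 2)`. With suitable constants the slope of `h` therefore survives normalizing the
direction, and gives a line derivative `D' ≥ D + 6 * L * q ^ 2` at a point of `F ε`. For `ε = 6 * L
* q ^ 2` this contradicts hypothesis 2, once its increment condition holds at that point.

That condition is why a point with large derivative is not enough.
`LipschitzWith.exists_deriv_ge_forall_abs_sub_le` finds one where all difference quotients of `h`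
are also bounded by a multiple of `√(h' * M)`. If there were none, the squared maximal function
would dominate `64 * M * h'` wherever `h'` is large, except near the ends, against the `L²` maximal
inequality. `abs_increment_sub_increment_le` then passes from the curve to the direction `e`: the
`O(L * q)` cost of tilting is absorbed because `√((D' - D) * L)` is itself at least `2 * L * q`. -/

/-! ### One-dimensional maximal inequalities. -/

open MeasureTheory Set Filter Topology in
/-- **Rising sun lemma** for Lipschitz functions, in integral form. -/
theorem LipschitzWith.setIntegral_deriv_shadow_nonneg {u : ℝ → ℝ} {C : ℝ≥0}
    (hu : LipschitzWith C u) {a b : ℝ} (hab : a ≤ b) :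
    0 ≤ ∫ τ in {τ ∈ Ioo a b | ∃ t ∈ Ioc τ b, u τ < u t}, deriv u τ := by
  set E := {τ ∈ Ioo a b | ∃ t ∈ Ioc τ b, u τ < u t} with hE
  have hEo : IsOpen E := by
    have : E = Ioo a b ∩ ⋃ t ∈ Iic b, {τ | τ < t ∧ u τ < u t} := by
      ext τ; simp [hE, and_assoc, and_comm, and_left_comm]
    rw [this]
    refine isOpen_Ioo.inter (isOpen_biUnion fun t _ => ?_)
    exact (isOpen_lt continuous_id continuous_const).inter
      (isOpen_lt hu.continuous continuous_const)
  -- Freezing `u` after `b` lets the supremum `N` below run over all later times. `N` is locally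
  -- constant at points of `E`, and `N - u` has a local minimum at the other points of the interval.
  -- So `u' - N'` is `u'` on `E` and `0` elsewhere, and its integral is `N a - u a ≥ 0`, because `N
  -- b = u b`.
  set k : ℝ → ℝ := fun t => u (min t b) with hk
  have hkL : ∀ s t, k s ≤ k t + C * |s - t| := by
    intro s t
    have h1 := hu.dist_le_mul (min s b) (min t b)
    rw [Real.dist_eq, Real.dist_eq] at h1
    have h2 : |min s b - min t b| ≤ |s - t| := by
      simpa using abs_min_sub_min_le_max s b t b
    have h3 := le_abs_self (u (min s b) - u (min t b))
    have h4 := mul_le_mul_of_nonneg_left h2 C.coe_nonneg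
    simp only [hk]
    linarith
  have hkb : ∀ t, b ≤ t → k t = u b := fun t ht => by simp [hk, ht]
  have hbdd : ∀ τ, BddAbove (range fun r : {r : ℝ // 0 ≤ r} => k (τ + r)) := by
    intro τ
    refine ⟨u b + C * |b - τ|, ?_⟩
    rintro _ ⟨⟨r, hr⟩, rfl⟩
    simp only
    rcases le_total b (τ + r) with h | h
    · rw [hkb _ h]; have : 0 ≤ (C : ℝ) * |b - τ| := by positivity
      linarith
    · have h1 := hkL (τ + r) b
      rw [hkb b le_rfl] at h1
      have : |τ + r - b| ≤ |b - τ| := by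
        rw [abs_of_nonpos (by linarith), abs_of_nonneg (by linarith)]; linarith
      have := mul_le_mul_of_nonneg_left this C.coe_nonneg
      linarith
  set N : ℝ → ℝ := fun τ => ⨆ r : {r : ℝ // 0 ≤ r}, k (τ + r) with hN
  have : Nonempty {r : ℝ // 0 ≤ r} := ⟨⟨0, le_rfl⟩⟩
  have hle : ∀ τ t, τ ≤ t → k t ≤ N τ := by
    intro τ t h
    have := le_ciSup (hbdd τ) ⟨t - τ, by linarith⟩
    simpa [hN] using this
  have hNle : ∀ τ c, (∀ t, τ ≤ t → k t ≤ c) → N τ ≤ c := by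
    intro τ c h
    exact ciSup_le fun r => h _ (by linarith [r.2])
  have hNL : LipschitzWith C N := by
    refine LipschitzWith.of_le_add_mul C fun s t => ?_
    refine ciSup_le fun r => ?_
    have h1 := hkL (s + r) (t + r)
    have h2 := hle t (t + r) (by linarith [r.2])
    rw [Real.dist_eq]
    rw [add_sub_add_right_eq_sub] at h1
    linarith
  have hNb : N b = u b := le_antisymm (hNle _ _ fun t ht => (hkb t ht).le)
    ((hkb b le_rfl).symm.le.trans (hle b b le_rfl))
  have hNa : u a ≤ N a := by
    have := hle a a le_rfl
    simpa [hk, hab] using this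
  have hac : ∀ {v : ℝ → ℝ}, LipschitzWith C v → AbsolutelyContinuousOnInterval v a b :=
    fun hv => hv.lipschitzOnWith.absolutelyContinuousOnInterval
  have key : ∀ᵐ τ, τ ∈ Ioo a b →
      deriv u τ - deriv N τ = E.indicator (deriv u) τ := by
    filter_upwards [hu.ae_differentiableAt_real, hNL.ae_differentiableAt_real] with τ h1 h2 hτ
    by_cases hτE : τ ∈ E
    · rw [indicator_of_mem hτE]
      suffices deriv N τ = 0 by rw [this, sub_zero]
      obtain ⟨-, t, ht, hut⟩ := hτE
      have hev : ∀ᶠ y in 𝓝 τ, y < t ∧ u y < u t :=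
        (eventually_lt_nhds ht.1).and (hu.continuous.continuousAt.eventually_lt_const hut)
      obtain ⟨δ, hδ, hball⟩ := Metric.eventually_nhds_iff_ball.1 hev
      have hku : ∀ r, r ≤ t → k r = u r := fun r hr => by simp [hk, hr.trans ht.2]
      have hz : τ + δ / 2 < t := (hball (τ + δ / 2) (by
        rw [Real.ball_eq_Ioo]; constructor <;> linarith)).1
      have hconst : N =ᶠ[𝓝 τ] fun _ => N (τ + δ / 2) := by
        filter_upwards [Metric.ball_mem_nhds τ (half_pos hδ)] with y hy
        rw [Real.ball_eq_Ioo] at hy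
        refine le_antisymm (hNle _ _ fun r hr => ?_)
          (hNle _ _ fun r hr => hle _ _ (hy.2.le.trans hr))
        rcases le_total (τ + δ / 2) r with hr' | hr'
        · exact hle _ _ hr'
        · have := (hball r (by rw [Real.ball_eq_Ioo]; constructor <;> linarith [hy.1])).2
          have h3 := hle _ t hz.le
          rw [hku t le_rfl] at h3
          rw [hku r (by linarith)]
          linarith
      rw [hconst.deriv_eq, deriv_const]
    · rw [indicator_of_notMem hτE]
      have hku : ∀ t, t ≤ b → k t = u t := fun t ht => by simp [hk, ht]
      have hNτ : N τ = u τ := by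
        refine le_antisymm (hNle _ _ fun t ht => ?_)
          ((hku τ hτ.2.le).symm.le.trans (hle τ τ le_rfl))
        rcases ht.eq_or_lt with rfl | ht
        · exact (hku _ hτ.2.le).le
        · by_contra! hc
          refine hτE ⟨hτ, min t b, ⟨lt_min ht hτ.2, min_le_right _ _⟩, hc⟩
      have hmin : IsLocalMin (fun y => N y - u y) τ := by
        filter_upwards [Iio_mem_nhds hτ.2] with y hy
        have := hle y y le_rfl
        rw [hku y (le_of_lt hy)] at this
        simp only [hNτ]; linarith
      have := hmin.deriv_eq_zero
      rw [deriv_fun_sub h2 h1] at this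
      linarith
  have h1 := (hac hu).integral_deriv_eq_sub
  have h2 := (hac hNL).integral_deriv_eq_sub
  have h3 : ∫ τ in E, deriv u τ = ∫ τ in a..b, (deriv u τ - deriv N τ) := by
    rw [intervalIntegral.integral_of_le hab, integral_Ioc_eq_integral_Ioo,
      setIntegral_congr_ae measurableSet_Ioo key, setIntegral_indicator hEo.measurableSet,
      inter_eq_right.2 fun τ h => h.1]
  rw [h3, intervalIntegral.integral_sub (hac hu).intervalIntegrable_deriv
    (hac hNL).intervalIntegrable_deriv, h1, h2, hNb]
  linarith

open MeasureTheory Set Filter Topology in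
/-- One-sided `L²` maximal inequality for difference quotients of a Lipschitz function. -/
theorem LipschitzWith.exists_right_maximal {h : ℝ → ℝ} {M : ℝ≥0}
    (hh : LipschitzWith M h) {a b : ℝ} (hab : a ≤ b) :
    ∃ R : ℝ → ℝ, Measurable R ∧ (∀ τ, 0 ≤ R τ) ∧ (∀ τ, R τ ≤ M) ∧
      (∀ τ t, τ ≤ t → t ≤ b → h t - h τ ≤ R τ * (t - τ)) ∧
      ∫ τ in Ioo a b, R τ ^ 2 ≤ 4 * ∫ τ in Ioo a b, deriv h τ ^ 2 := by
  classical
  have hlip : ∀ τ t, τ < t → h t - h τ ≤ M * (t - τ) := by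
    intro τ t ht
    have := hh.dist_le_mul t τ
    rw [Real.dist_eq, Real.dist_eq, abs_of_pos (sub_pos.2 ht)] at this
    exact (le_abs_self _).trans this
  -- The default value `0` truncates the supremum `R` from below, and covers `τ ≥ b`, where no `t`
  -- is admissible.
  set Q : ℝ → ℝ → ℝ := fun τ t => if t ∈ Ioc τ b then (h t - h τ) / (t - τ) else 0 with hQ
  set R : ℝ → ℝ := fun τ => ⨆ t, Q τ t with hR
  have hQM : ∀ τ t, Q τ t ≤ M := by
    intro τ t
    simp only [hQ]
    split_ifs with ht
    · rw [div_le_iff₀ (sub_pos.2 ht.1)]; exact hlip τ t ht.1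
    · exact M.coe_nonneg
  have hbdd : ∀ τ, BddAbove (range (Q τ)) := fun τ => ⟨M, by rintro _ ⟨t, rfl⟩; exact hQM τ t⟩
  have hR0 : ∀ τ, 0 ≤ R τ := by
    intro τ
    refine le_ciSup_of_le (hbdd τ) (b + 1) ?_
    simp only [hQ]
    rw [if_neg fun h => by linarith [h.2]]
  have hRM : ∀ τ, R τ ≤ M := fun τ => ciSup_le (hQM τ)
  have hlt : ∀ l : ℝ, 0 ≤ l → ∀ τ, l < R τ ↔ ∃ t ∈ Ioc τ b, l * (t - τ) < h t - h τ := by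
    intro l hl τ
    rw [hR, lt_ciSup_iff (hbdd τ)]
    refine exists_congr fun t => ?_
    simp only [hQ]
    split_ifs with ht
    · rw [lt_div_iff₀ (sub_pos.2 ht.1)]; simp [ht]
    · simp [ht, hl]
  have hmeas : Measurable R := by
    refine measurable_of_Ioi fun l => ?_
    rcases lt_or_ge l 0 with hl | hl
    · convert MeasurableSet.univ
      ext τ; simp [hl.trans_le (hR0 τ)]
    · have : R ⁻¹' Ioi l = ⋃ t ∈ Iic b, {τ | τ < t ∧ l * (t - τ) < h t - h τ} := by
        ext τ
        simp only [mem_preimage, mem_Ioi, hlt l hl, mem_iUnion, mem_Ioc, mem_Iic, exists_prop,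
          mem_ofPred_eq]
        exact exists_congr fun t => by tauto
      rw [this]
      refine (isOpen_biUnion fun t _ => ?_).measurableSet
      exact (isOpen_lt continuous_id continuous_const).inter
        (isOpen_lt (by fun_prop) (continuous_const.sub hh.continuous))
  have hdM : ∀ τ, |deriv h τ| ≤ M := fun τ => norm_deriv_le_of_lipschitz hh
  have hdm : Measurable (deriv h) := measurable_deriv h
  have hint : ∀ {v : ℝ → ℝ} {B : ℝ}, Measurable v → (∀ τ, |v τ| ≤ B) →
      Integrable v (volume.restrict (Ioo a b)) := fun hv hB =>
    Integrable.of_bound hv.aestronglyMeasurable _ (ae_of_all _ hB)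
  -- Weak-type bound: `{R > l}` is the shadow set of `h t - l * t`. The factor `2 * l` is the
  -- derivative of `l ^ 2`, ready for the layer cake formula.
  have weak : ∀ l : ℝ, 0 < l → volume.restrict (Ioo a b) {τ | l < R τ} * ENNReal.ofReal (2 * l) ≤
      2 * ((volume.restrict (Ioo a b)).withDensity fun τ => ENNReal.ofReal |deriv h τ|)
        {τ | l < R τ} := by
    intro l hl
    have hE : MeasurableSet {τ | l < R τ} := measurableSet_lt measurable_const hmeas
    have hul : LipschitzWith (M + ⟨l, hl.le⟩) fun t => h t - l * t :=
      hh.sub (LipschitzWith.of_dist_le_mul fun x y => by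
        simp only [Real.dist_eq, ← mul_sub, abs_mul, abs_of_pos hl]; rfl)
    have h1 := hul.setIntegral_deriv_shadow_nonneg hab
    have hset : {τ ∈ Ioo a b | ∃ t ∈ Ioc τ b, h τ - l * τ < h t - l * t} =
        {τ | l < R τ} ∩ Ioo a b := by
      ext τ
      simp only [mem_ofPred_eq, mem_inter_iff, hlt l hl.le]
      rw [and_comm]
      refine and_congr_left fun _ => exists_congr fun t => and_congr_right fun _ => ?_
      constructor <;> intro h <;> linarith
    rw [hset, ← Measure.restrict_restrict hE] at h1
    set μ := volume.restrict (Ioo a b) with hμ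
    have hI : Integrable (deriv h) μ := hint hdm hdM
    have h2 : ∫ τ in {τ | l < R τ}, deriv (fun t => h t - l * t) τ ∂μ =
        ∫ τ in {τ | l < R τ}, (deriv h τ - l) ∂μ := by
      refine integral_congr_ae (ae_restrict_of_ae (ae_restrict_of_ae ?_))
      filter_upwards [hh.ae_differentiableAt_real] with τ hτ
      rw [deriv_fun_sub hτ (by fun_prop)]
      simp
    rw [h2, integral_sub hI.restrict (integrable_const l)] at h1
    have h3 : ∫ τ in {τ | l < R τ}, deriv h τ ∂μ ≤ ∫ τ in {τ | l < R τ}, |deriv h τ| ∂μ :=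
      integral_mono hI.restrict hI.abs.restrict fun τ => le_abs_self _
    rw [withDensity_apply _ hE, ← ofReal_integral_eq_lintegral_ofReal hI.abs.restrict
      (ae_of_all _ fun τ => abs_nonneg _)]
    rw [← ENNReal.ofReal_toReal (measure_ne_top μ {τ | l < R τ}),
      ← ENNReal.ofReal_mul ENNReal.toReal_nonneg,
      show (2 : ENNReal) = ENNReal.ofReal 2 by simp, ← ENNReal.ofReal_mul (by norm_num)]
    apply ENNReal.ofReal_le_ofReal
    simp only [integral_const, smul_eq_mul, Measure.real, Measure.restrict_apply_univ] at h1
    linarith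
  refine ⟨R, hmeas, hR0, hRM, ?_, ?_⟩
  · intro τ t h1 h2
    rcases h1.eq_or_lt with rfl | h1
    · simp
    · by_contra! hc
      have : R τ < R τ := (hlt (R τ) (hR0 τ) τ).2 ⟨t, ⟨h1, h2⟩, hc⟩
      exact this.false
  · set μ := volume.restrict (Ioo a b) with hμ
    have hIR : Integrable (fun τ => R τ ^ 2) μ := hint (B := (M : ℝ) ^ 2) (by fun_prop) fun τ => by
      rw [abs_of_nonneg (sq_nonneg _)]; exact pow_le_pow_left₀ (hR0 τ) (hRM τ) 2
    have hId : Integrable (fun τ => deriv h τ ^ 2) μ :=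
      hint (B := (M : ℝ) ^ 2) (by fun_prop) fun τ => by
        rw [abs_of_nonneg (sq_nonneg _), ← sq_abs]
        exact pow_le_pow_left₀ (abs_nonneg _) (hdM τ) 2
    have hIp : Integrable (fun τ => |deriv h τ| * R τ) μ :=
      hint (B := (M : ℝ) * M) (by fun_prop) fun τ => by
        rw [abs_of_nonneg (mul_nonneg (abs_nonneg _) (hR0 τ))]
        exact mul_le_mul (hdM τ) (hRM τ) (hR0 τ) M.coe_nonneg
    have h1 := lintegral_comp_eq_lintegral_meas_lt_mul μ (f := R) (g := fun t => 2 * t)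
      (ae_of_all _ hR0) hmeas.aemeasurable
      (fun t _ => (by fun_prop : Continuous fun t : ℝ => 2 * t).intervalIntegrable _ _)
      ((ae_restrict_mem measurableSet_Ioi).mono fun t (ht : 0 < t) => by
        simpa using ht.le)
    have h2 := lintegral_eq_lintegral_meas_lt
      (μ.withDensity fun τ => ENNReal.ofReal |deriv h τ|) (f := R)
      (ae_of_all _ hR0) hmeas.aemeasurable
    have h3 : ∫⁻ τ, ENNReal.ofReal (R τ ^ 2) ∂μ ≤
        2 * ∫⁻ τ, ENNReal.ofReal (|deriv h τ| * R τ) ∂μ := by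
      calc ∫⁻ τ, ENNReal.ofReal (R τ ^ 2) ∂μ
          = ∫⁻ τ, ENNReal.ofReal (∫ t in (0 : ℝ)..R τ, 2 * t) ∂μ := by
            refine lintegral_congr fun τ => ?_
            rw [intervalIntegral.integral_const_mul, integral_id]; congr 1; ring
        _ ≤ ∫⁻ t in Ioi (0 : ℝ),
              2 * (μ.withDensity fun τ => ENNReal.ofReal |deriv h τ|) {τ | t < R τ} := by
            rw [h1]
            exact setLIntegral_mono' measurableSet_Ioi fun t ht => weak t ht
        _ = 2 * ∫⁻ τ, ENNReal.ofReal (|deriv h τ| * R τ) ∂μ := by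
            rw [lintegral_const_mul' _ _ (by simp), ← h2,
              lintegral_withDensity_eq_lintegral_mul _ (by fun_prop) (by fun_prop)]
            congr 1
            refine lintegral_congr fun τ => ?_
            rw [Pi.mul_apply, ENNReal.ofReal_mul (abs_nonneg _)]
    rw [← ofReal_integral_eq_lintegral_ofReal hIR (ae_of_all _ fun τ => sq_nonneg _),
      ← ofReal_integral_eq_lintegral_ofReal hIp
        (ae_of_all _ fun τ => mul_nonneg (abs_nonneg _) (hR0 τ)),
      show (2 : ENNReal) = ENNReal.ofReal 2 by simp, ← ENNReal.ofReal_mul (by norm_num),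
      ENNReal.ofReal_le_ofReal_iff (mul_nonneg (by norm_num)
        (integral_nonneg fun τ => mul_nonneg (abs_nonneg _) (hR0 τ)))] at h3
    -- Young's inequality, weighted so that half of `∫ R ^ 2` is absorbed on the left; this yields
    -- the constant `4`.
    have h4 : ∫ τ, |deriv h τ| * R τ ∂μ ≤ ∫ τ, (deriv h τ ^ 2 + 1 / 4 * R τ ^ 2) ∂μ :=
      integral_mono hIp (hId.add (hIR.const_mul _)) fun τ => by
        have := sq_nonneg (|deriv h τ| - R τ / 2)
        simp only
        rw [← sq_abs (deriv h τ)]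
        linarith
    rw [integral_add hId (hIR.const_mul _), integral_const_mul] at h4
    linarith

open MeasureTheory Set in
/-- Two-sided `L²` maximal inequality for difference quotients of a Lipschitz function. -/
theorem LipschitzWith.exists_sq_maximal {h : ℝ → ℝ} {M : ℝ≥0}
    (hh : LipschitzWith M h) {s : ℝ} (hs : 0 ≤ s) :
    ∃ W : ℝ → ℝ, Measurable W ∧ (∀ τ, 0 ≤ W τ) ∧ (∀ τ, W τ ≤ 4 * (M : ℝ) ^ 2) ∧
      (∀ τ ∈ Icc (-s) s, ∀ t ∈ Icc (-s) s, (h t - h τ) ^ 2 ≤ W τ * (t - τ) ^ 2) ∧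
      ∫ τ in Ioo (-s) s, W τ ≤ 16 * ∫ τ in Ioo (-s) s, deriv h τ ^ 2 := by
  have hss : -s ≤ s := by linarith
  have hr : LipschitzWith M fun t => h (-t) :=
    LipschitzWith.of_dist_le_mul fun x y => by
      simpa only [dist_neg_neg] using hh.dist_le_mul (-x) (-y)
  obtain ⟨A, hA, hA0, hAM, hAh, hAi⟩ := hh.exists_right_maximal hss
  obtain ⟨B, hB, hB0, hBM, hBh, hBi⟩ := hh.neg.exists_right_maximal hss
  obtain ⟨C, hC, hC0, hCM, hCh, hCi⟩ := hr.exists_right_maximal hss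
  obtain ⟨E, hE, hE0, hEM, hEh, hEi⟩ := hr.neg.exists_right_maximal hss
  have hrefl : ∀ v : ℝ → ℝ, ∫ τ in Ioo (-s) s, v (-τ) = ∫ τ in Ioo (-s) s, v τ := by
    intro v
    rw [← integral_Ioc_eq_integral_Ioo, ← integral_Ioc_eq_integral_Ioo,
      ← intervalIntegral.integral_of_le hss, ← intervalIntegral.integral_of_le hss,
      intervalIntegral.integral_comp_neg, neg_neg]
  have hdr : ∀ τ, deriv (fun t => h (-t)) τ ^ 2 = deriv h (-τ) ^ 2 := fun τ => by
    rw [deriv_comp_neg, neg_sq]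
  have hdn : ∀ (v : ℝ → ℝ) τ, deriv (-v) τ ^ 2 = deriv v τ ^ 2 := fun v τ => by
    rw [deriv.neg', neg_sq]
  simp only [hdn, hdr, hrefl fun τ => deriv h τ ^ 2] at hBi hCi hEi
  rw [← hrefl fun τ => C τ ^ 2] at hCi
  rw [← hrefl fun τ => E τ ^ 2] at hEi
  have hint : ∀ {R : ℝ → ℝ}, Measurable R → (∀ τ, 0 ≤ R τ) → (∀ τ, R τ ≤ M) →
      IntegrableOn (fun τ => R τ ^ 2) (Ioo (-s) s) := fun hR h0 hM =>
    Integrable.of_bound (by fun_prop) ((M : ℝ) ^ 2) (ae_of_all _ fun τ => by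
      rw [Real.norm_of_nonneg (sq_nonneg _)]; exact pow_le_pow_left₀ (h0 τ) (hM τ) 2)
  have hC' : Measurable fun τ => C (-τ) := by fun_prop
  have hE' : Measurable fun τ => E (-τ) := by fun_prop
  -- The four terms bound rises and falls of `h`, to the right and to the left of `τ`.
  refine ⟨fun τ => A τ ^ 2 + B τ ^ 2 + (C (-τ) ^ 2 + E (-τ) ^ 2), by fun_prop,
    fun τ => by positivity, fun τ => ?_, fun τ hτ t ht => ?_, ?_⟩
  · have := pow_le_pow_left₀ (hA0 τ) (hAM τ) 2
    have := pow_le_pow_left₀ (hB0 τ) (hBM τ) 2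
    have := pow_le_pow_left₀ (hC0 (-τ)) (hCM (-τ)) 2
    have := pow_le_pow_left₀ (hE0 (-τ)) (hEM (-τ)) 2
    simp only; linarith
  · have hsq : ∀ {d X Y l : ℝ}, 0 ≤ X → 0 ≤ Y → 0 ≤ l → d ≤ X * l → -d ≤ Y * l →
        d ^ 2 ≤ (X ^ 2 + Y ^ 2) * l ^ 2 := by
      intro d X Y l hX hY hl h1 h2
      rcases le_total 0 d with hd | hd
      · have := pow_le_pow_left₀ hd h1 2
        nlinarith [mul_nonneg (sq_nonneg Y) (sq_nonneg l)]
      · have := pow_le_pow_left₀ (neg_nonneg.2 hd) h2 2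
        nlinarith [mul_nonneg (sq_nonneg X) (sq_nonneg l)]
    rcases le_total τ t with hl | hl
    · have h1 := hAh τ t hl ht.2
      have h2 := hBh τ t hl ht.2
      simp only [Pi.neg_apply] at h2
      have := hsq (hA0 τ) (hB0 τ) (sub_nonneg.2 hl) h1 (by linarith)
      nlinarith [mul_nonneg (add_nonneg (sq_nonneg (C (-τ))) (sq_nonneg (E (-τ))))
        (sq_nonneg (t - τ))]
    · have h1 := hCh (-τ) (-t) (by linarith) (by linarith [ht.1])
      have h2 := hEh (-τ) (-t) (by linarith) (by linarith [ht.1])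
      simp only [Pi.neg_apply, neg_neg] at h1 h2
      have := hsq (hC0 (-τ)) (hE0 (-τ)) (show 0 ≤ -t - -τ by linarith) h1 (by linarith)
      nlinarith [mul_nonneg (add_nonneg (sq_nonneg (A τ)) (sq_nonneg (B τ)))
        (sq_nonneg (t - τ))]
  · have iA := hint hA hA0 hAM
    have iB := hint hB hB0 hBM
    have iC := hint hC' (fun τ => hC0 _) (fun τ => hCM _)
    have iE := hint hE' (fun τ => hE0 _) (fun τ => hEM _)
    have h1 := integral_add (iA.add iB) (iC.add iE)
    simp only [Pi.add_apply] at h1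
    rw [h1, integral_add iA iB, integral_add iC iE]
    linarith

/-! ### Selection of a point with large derivative and controlled difference quotients. -/

open MeasureTheory Set in
/-- If a Lipschitz function on `[-s, s]` has nearly equal values at the end points but a different
value at `ξ`, then away from the end points it has a large derivative at some `τ` at which the
global difference quotients are controlled by the square root of the derivative. -/
theorem LipschitzWith.exists_deriv_ge_forall_abs_sub_le {h : ℝ → ℝ} {M : ℝ≥0}
    (hh : LipschitzWith M h) (hM : 0 < M) {s ξ c κ : ℝ} (hs : 0 < s) (hξ : ξ ∈ Icc (-s) s)
    (hc : 0 ≤ c) (hκ : 0 < κ) (hκ1 : κ ≤ 1)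
    (H : 2 * s * c + 2 * κ * s * M + |h s - h (-s)| / 2 <
      (|h ξ - h (-s)| + |h s - h ξ|) / 4) :
    ∃ τ, |τ| ≤ s * (1 - κ) ∧ τ ≠ ξ ∧ DifferentiableAt ℝ h τ ∧ c ≤ deriv h τ ∧
      ∀ t ∈ Icc (-s) s, |h t - h τ| ≤ 8 * √(deriv h τ * M) * |t - τ| := by
  have hM' : (0 : ℝ) < M := hM
  obtain ⟨W, hW, hW0, hWM, hWh, hWi⟩ := hh.exists_sq_maximal hs.le
  have hss : -s ≤ s := by linarith
  by_contra! hno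
  set μ := volume.restrict (Ioo (-s) s) with hμ
  have hdM : ∀ τ, |deriv h τ| ≤ M := fun τ => norm_deriv_le_of_lipschitz hh
  have hdm : Measurable (deriv h) := measurable_deriv h
  set P : Set ℝ := Icc (-(s * (1 - κ))) (s * (1 - κ)) with hP
  have hPm : MeasurableSet P := measurableSet_Icc
  have hPs : P ⊆ Ioo (-s) s := fun τ hτ => by
    have := mul_pos hs hκ
    constructor <;> nlinarith [hτ.1, hτ.2]
  -- Bound for the positive part of `h'`: below `c` it is trivial, outside `P` it is at most `M`,
  -- and elsewhere the failure of the conclusion forces `W τ > 64 * M * h'`.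
  have hae : ∀ᵐ τ ∂μ, (|deriv h τ| + deriv h τ) / 2 ≤
      c + (M - P.indicator (fun _ => (M : ℝ)) τ) + W τ / (64 * M) := by
    have hne : ∀ᵐ τ : ℝ, τ ≠ ξ := by simp [ae_iff, measure_singleton]
    filter_upwards [ae_restrict_of_ae hh.ae_differentiableAt_real, ae_restrict_of_ae hne,
      ae_restrict_mem measurableSet_Ioo] with τ h1 h2 h3
    have hw : 0 ≤ W τ / (64 * M) := div_nonneg (hW0 τ) (by positivity)
    have hd := hdM τ
    by_cases hτ : τ ∈ P
    · rw [indicator_of_mem hτ, sub_self, add_zero]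
      rcases lt_or_ge (deriv h τ) c with hlt | hge
      · rcases le_total 0 (deriv h τ) with h0 | h0
        · rw [abs_of_nonneg h0]; linarith
        · rw [abs_of_nonpos h0]; linarith
      · have h0 := hc.trans hge
        rw [abs_of_nonneg h0]
        obtain ⟨t, ht, hlt⟩ := hno τ (abs_le.2 hτ) h2 h1 hge
        have h4 := hWh τ ⟨h3.1.le, h3.2.le⟩ t ht
        have h5 := pow_lt_pow_left₀ hlt (by positivity) two_ne_zero
        rw [sq_abs, mul_pow, mul_pow, Real.sq_sqrt (by positivity), sq_abs] at h5
        have h6 : 8 ^ 2 * (deriv h τ * M) < W τ :=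
          lt_of_mul_lt_mul_right (h5.trans_le h4) (sq_nonneg _)
        have : deriv h τ ≤ W τ / (64 * M) := by
          rw [le_div_iff₀ (by positivity)]; linarith
        linarith
    · rw [indicator_of_notMem hτ]
      linarith [le_abs_self (deriv h τ)]
  have hint : ∀ {v : ℝ → ℝ} {B : ℝ}, Measurable v → (∀ τ, |v τ| ≤ B) → Integrable v μ :=
    fun hv hB => Integrable.of_bound hv.aestronglyMeasurable _ (ae_of_all _ hB)
  have id : Integrable (deriv h) μ := hint hdm hdM
  have iW : Integrable W μ := hint hW fun τ => by rw [abs_of_nonneg (hW0 τ)]; exact hWM τ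
  have iP : Integrable (P.indicator fun _ => (M : ℝ)) μ := (integrable_const _).indicator hPm
  have i2 : Integrable (fun τ => deriv h τ ^ 2) μ :=
    hint (B := (M : ℝ) ^ 2) (by fun_prop) fun τ => by
      rw [abs_of_nonneg (sq_nonneg _), ← sq_abs]
      exact pow_le_pow_left₀ (abs_nonneg _) (hdM τ) 2
  have h1 := integral_mono_ae ((id.abs.add id).div_const 2)
    (((integrable_const c).add ((integrable_const (M : ℝ)).sub iP)).add (iW.div_const _)) hae
  have hvol : ∀ r : ℝ, ∫ _ in Ioo (-s) s, r = 2 * s * r := fun r => by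
    simp [Measure.real, ENNReal.toReal_ofReal (show 0 ≤ s + s by linarith), two_mul]
  have hvP : ∫ τ, P.indicator (fun _ => (M : ℝ)) τ ∂μ = 2 * s * (1 - κ) * M := by
    rw [hμ, setIntegral_indicator hPm, inter_eq_right.2 hPs]
    have : 0 ≤ s * (1 - κ) := mul_nonneg hs.le (by linarith)
    simp [hP, Measure.real, ENNReal.toReal_ofReal (add_nonneg this this)]
    rw [← two_mul, mul_assoc 2 s]
    exact Or.inl rfl
  have i3 : Integrable (fun τ => M - P.indicator (fun _ => (M : ℝ)) τ) μ :=
    (integrable_const _).sub iP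
  have i4 : Integrable (fun τ => c + (M - P.indicator (fun _ => (M : ℝ)) τ)) μ :=
    (integrable_const c).add i3
  simp only [Pi.add_apply, Pi.sub_apply] at h1
  rw [integral_div, integral_add id.abs id, integral_add i4 (iW.div_const _),
    integral_add (integrable_const c) i3,
    integral_sub (integrable_const (M : ℝ)) iP, hvP, integral_div, hvol, hvol] at h1
  have h2 : ∫ τ, deriv h τ ^ 2 ∂μ ≤ M * ∫ τ, |deriv h τ| ∂μ := by
    rw [← integral_const_mul]
    refine integral_mono i2 (id.abs.const_mul _) fun τ => ?_
    simp only
    rw [← sq_abs, sq]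
    exact mul_le_mul_of_nonneg_right (hdM τ) (abs_nonneg _)
  -- The maximal term costs a quarter of `∫ |h'|`, while the positive part carries half of it up to
  -- `(h s - h (-s)) / 2`. The remaining quarter bounds the variation in `H`.
  have h3 : (∫ τ, W τ ∂μ) / (64 * M) ≤ (∫ τ, |deriv h τ| ∂μ) / 4 := by
    rw [div_le_iff₀ (by positivity)]
    linarith
  have hac : ∀ x y, AbsolutelyContinuousOnInterval h x y := fun x y =>
    hh.lipschitzOnWith.absolutelyContinuousOnInterval
  have h4 : ∫ τ, deriv h τ ∂μ = h s - h (-s) := by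
    rw [← (hac _ _).integral_deriv_eq_sub, intervalIntegral.integral_of_le hss,
      integral_Ioc_eq_integral_Ioo]
  have habs : ∀ x y, x ≤ y → |h y - h x| ≤ ∫ τ in x..y, |deriv h τ| := fun x y hxy => by
    rw [← (hac x y).integral_deriv_eq_sub]
    exact intervalIntegral.abs_integral_le_integral_abs hxy
  have h5 : |h ξ - h (-s)| + |h s - h ξ| ≤ ∫ τ, |deriv h τ| ∂μ := by
    rw [hμ, ← integral_Ioc_eq_integral_Ioo, ← intervalIntegral.integral_of_le hss,
      ← intervalIntegral.integral_add_adjacent_intervals (b := ξ)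
        (hac _ _).intervalIntegrable_deriv.abs (hac _ _).intervalIntegrable_deriv.abs]
    exact add_le_add (habs _ _ hξ.1) (habs _ _ hξ.2)
  rw [h4] at h1
  have := neg_abs_le (h s - h (-s))
  linarith

/-! ### Geometry of the broken line. -/

/-- A broken line whose two slopes are bounded by `K` is `K`-Lipschitz. -/
theorem norm_brokenLine_sub_le {E : Type*} [NormedAddCommGroup E] [NormedSpace ℝ E]
    {a b : E} {K : ℝ} (ha : ‖a‖ ≤ K) (hb : ‖b‖ ≤ K) (ξ t τ : ℝ) :
    ‖(t - ξ) • (if t ≤ ξ then a else b) - (τ - ξ) • (if τ ≤ ξ then a else b)‖ ≤ K * |t - τ| := by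
  have aux : ∀ {c : E}, ‖c‖ ≤ K → ∀ y : ℝ, ‖y • c‖ ≤ K * |y| := fun hc y => by
    rw [norm_smul, Real.norm_eq_abs, mul_comm]
    exact mul_le_mul_of_nonneg_right hc (abs_nonneg _)
  split_ifs with h1 h2 h2
  · rw [← sub_smul, sub_sub_sub_cancel_right]; exact aux ha _
  · have h3 := norm_sub_le ((t - ξ) • a) ((τ - ξ) • b)
    have h4 := aux ha (t - ξ)
    have h5 := aux hb (τ - ξ)
    rw [abs_of_nonpos (by linarith)] at h4 ⊢
    rw [abs_of_nonneg (by linarith)] at h5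
    linarith
  · have h3 := norm_sub_le ((t - ξ) • b) ((τ - ξ) • a)
    have h4 := aux hb (t - ξ)
    have h5 := aux ha (τ - ξ)
    rw [abs_of_nonneg (by linarith)] at h4 ⊢
    rw [abs_of_nonpos (by linarith)] at h5
    linarith
  · rw [← sub_smul, sub_sub_sub_cancel_right]; exact aux hb _

section

variable {H : Type*} [NormedAddCommGroup H] [InnerProductSpace ℝ H]

/-- The slope of a segment from near `-e` to near `q • u`, parametrized by the `e`-coordinate,
differs from `e` by `O(q)`, and its norm exceeds `1` by `O(q ^ 2)` only. -/
theorem norm_slope_bounds {e u z : H} (he : ‖e‖ = 1) (hu : ‖u‖ = 1) {q : ℝ} (hq : 0 < q)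
    (hq1 : q ≤ 1 / 2) (hz : ‖z - (q • u + e)‖ ≤ q ^ 2 / 2) :
    ‖(1 + q * ⟪u, e⟫)⁻¹ • z - e‖ ≤ 3 * q ∧ ‖(1 + q * ⟪u, e⟫)⁻¹ • z‖ ≤ 1 + 3 * q ^ 2 := by
  set i : ℝ := ⟪u, e⟫ with hi
  have hi1 : |i| ≤ 1 := by simpa [he, hu] using abs_real_inner_le_norm u e
  have hpos : 1 / 2 ≤ 1 + q * i := by nlinarith [neg_abs_le i]
  set c : ℝ := (1 + q * i)⁻¹ with hc
  have hc0 : 0 < c := by positivity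
  have hc2 : c ≤ 2 := by
    rw [hc]; exact inv_le_of_inv_le₀ (by norm_num) (by linarith)
  have hee : ⟪e, e⟫ = 1 := by rw [real_inner_self_eq_norm_sq, he]; norm_num
  have hperp : ⟪e, u - i • e⟫ = 0 := by
    rw [inner_sub_right, inner_smul_right, hee, real_inner_comm, ← hi]; ring
  have hun : ‖u - i • e‖ ≤ 1 := by
    have h1 : ‖u - i • e‖ ^ 2 = 1 - i ^ 2 := by
      rw [norm_sub_sq_real, inner_smul_right, norm_smul, he, hu, ← hi, mul_one,
        Real.norm_eq_abs, sq_abs]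
      ring
    nlinarith [norm_nonneg (u - i • e), sq_nonneg i]
  -- `a` is orthogonal to `e`, so its size `O(q)` enters the norm only quadratically; `b` is the
  -- error in `z`.
  set a : H := (c * q) • (u - i • e) with ha
  set b : H := c • (z - (q • u + e)) with hb
  have hdec : c • z = e + a + b := by
    have h1 : c * (1 + q * i) = 1 := inv_mul_cancel₀ (by linarith)
    have h2 : e = (c * (1 + q * i)) • e := by rw [h1, one_smul]
    rw [ha, hb]
    nth_rw 1 [h2]
    module
  have han : ‖a‖ ≤ 2 * q := by
    rw [ha, norm_smul, Real.norm_of_nonneg (by positivity)]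
    have : c * q ≤ 2 * q := mul_le_mul_of_nonneg_right hc2 hq.le
    nlinarith [norm_nonneg (u - i • e), mul_pos hc0 hq]
  have hbn : ‖b‖ ≤ q ^ 2 := by
    rw [hb, norm_smul, Real.norm_of_nonneg hc0.le]
    nlinarith [norm_nonneg (z - (q • u + e))]
  have hea : ‖e + a‖ ≤ 1 + 2 * q ^ 2 := by
    have h1 : ‖e + a‖ ^ 2 = 1 + ‖a‖ ^ 2 := by
      rw [norm_add_sq_real, he, ha, inner_smul_right, hperp]; ring
    have h2 := pow_le_pow_left₀ (norm_nonneg a) han 2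
    refine le_of_sq_le_sq ?_ (by positivity)
    nlinarith [sq_nonneg (q ^ 2)]
  constructor
  · rw [hdec, add_assoc, add_sub_cancel_left]
    have := norm_add_le a b
    nlinarith
  · rw [hdec]
    have := norm_add_le (e + a) b
    linarith

/-- The broken line through `x + s • v₁`, `x + s • v₃`, `x + s • v₂`, where `v₁, v₂, v₃` are close
to `-e`, `e`, `q • u`, parametrized by the `e`-coordinate. -/
theorem exists_brokenLine {x e u v₁ v₂ v₃ : H} (he : ‖e‖ = 1) (hu : ‖u‖ = 1) {q s : ℝ}
    (hq : 0 < q) (hq1 : q ≤ 1 / 2) (hs : 0 < s) (hv₁ : ‖v₁ - -e‖ ≤ q ^ 2 / 4)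
    (hv₂ : ‖v₂ - e‖ ≤ q ^ 2 / 4) (hv₃ : ‖v₃ - q • u‖ ≤ q ^ 2 / 4) :
    ∃ g : ℝ → H, (∀ t τ, ‖g t - g τ - (t - τ) • e‖ ≤ 3 * q * |t - τ|) ∧
      (∀ t τ, ‖g t - g τ‖ ≤ (1 + 3 * q ^ 2) * |t - τ|) ∧
      (∀ τ, τ ≠ s * (q * ⟪u, e⟫) → ∃ w : H, ‖w - e‖ ≤ 3 * q ∧ ‖w‖ ≤ 1 + 3 * q ^ 2 ∧
        ∀ᶠ t in nhds τ, g t = g τ + (t - τ) • w) ∧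
      g (-s) = x + s • v₁ ∧ g (s * (q * ⟪u, e⟫)) = x + s • v₃ ∧ g s = x + s • v₂ ∧
      ∀ τ ∈ Set.Icc (-s) s, g τ ∈ segment ℝ (x + s • v₁) (x + s • v₃) ∪
        segment ℝ (x + s • v₃) (x + s • v₂) := by
  set i : ℝ := ⟪u, e⟫ with hi
  have hi1 : |i| ≤ 1 := by simpa [he, hu] using abs_real_inner_le_norm u e
  have hp1 : 0 < 1 + q * i := by nlinarith [neg_abs_le i]
  have hp2 : 0 < 1 - q * i := by nlinarith [le_abs_self i]
  have hb1 := norm_slope_bounds (z := v₃ - v₁) he hu hq hq1 (by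
    have := norm_sub_le (v₃ - q • u) (v₁ - -e)
    rw [show v₃ - v₁ - (q • u + e) = v₃ - q • u - (v₁ - -e) by abel]
    linarith)
  -- The second half is the first with `u` replaced by `-u`.
  have hb2 := norm_slope_bounds (z := v₂ - v₃) (u := -u) he (by rwa [norm_neg]) hq hq1 (by
    have := norm_sub_le (v₂ - e) (v₃ - q • u)
    rw [show v₂ - v₃ - (q • -u + e) = v₂ - e - (v₃ - q • u) by rw [smul_neg]; abel]
    linarith)
  rw [inner_neg_left, mul_neg, ← sub_eq_add_neg] at hb2
  rw [← hi] at hb1 hb2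
  set w₁ := (1 + q * i)⁻¹ • (v₃ - v₁) with hw₁
  set w₂ := (1 - q * i)⁻¹ • (v₂ - v₃) with hw₂
  set ξ := s * (q * i) with hξ
  have hsw₁ : (s * (1 + q * i)) • w₁ = s • (v₃ - v₁) := by
    rw [hw₁, smul_smul, mul_assoc, mul_inv_cancel₀ hp1.ne', mul_one]
  have hsw₂ : (s * (1 - q * i)) • w₂ = s • (v₂ - v₃) := by
    rw [hw₂, smul_smul, mul_assoc, mul_inv_cancel₀ hp2.ne', mul_one]
  have hξ1 : -s < ξ := by nlinarith
  have hξ2 : ξ < s := by nlinarith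
  set g : ℝ → H := fun t => x + s • v₃ + (t - ξ) • (if t ≤ ξ then w₁ else w₂) with hg
  have hgl : ∀ t, t ≤ ξ → g t = x + s • v₃ + (t - ξ) • w₁ := fun t ht => by simp [hg, ht]
  have hgr : ∀ t, ξ < t → g t = x + s • v₃ + (t - ξ) • w₂ := fun t ht => by
    simp [hg, not_le.2 ht]
  refine ⟨g, fun t τ => ?_, fun t τ => ?_, fun τ hτ => ?_, ?_, ?_, ?_, fun τ hτ => ?_⟩
  · refine le_of_eq_of_le ?_ (norm_brokenLine_sub_le hb1.1 hb2.1 ξ t τ)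
    congr 1
    simp only [hg]
    split_ifs <;> module
  · refine le_of_eq_of_le ?_ (norm_brokenLine_sub_le hb1.2 hb2.2 ξ t τ)
    congr 1
    simp only [hg]
    abel
  · rcases hτ.lt_or_gt with h | h
    · refine ⟨w₁, hb1.1, hb1.2, ?_⟩
      filter_upwards [Iio_mem_nhds h] with t ht
      rw [hgl t (le_of_lt ht), hgl τ h.le]
      module
    · refine ⟨w₂, hb2.1, hb2.2, ?_⟩
      filter_upwards [Ioi_mem_nhds h] with t ht
      rw [hgr t ht, hgr τ h]
      module
  · rw [hgl _ hξ1.le, show -s - ξ = -(s * (1 + q * i)) by rw [hξ]; ring, neg_smul, hsw₁]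
    module
  · rw [hgl _ le_rfl, sub_self, zero_smul, add_zero]
  · rw [hgr _ hξ2, show s - ξ = s * (1 - q * i) by rw [hξ]; ring, hsw₂]
    module
  · rcases le_or_gt τ ξ with h | h
    · left
      rw [segment_symm, segment_eq_image']
      refine ⟨(ξ - τ) / (s * (1 + q * i)), ⟨div_nonneg (by linarith) (by positivity), ?_⟩, ?_⟩
      · rw [div_le_one (by positivity)]
        linarith [hτ.1, show s * (1 + q * i) = s + ξ by rw [hξ]; ring]
      · rw [hgl τ h]
        simp only
        rw [show x + s • v₁ - (x + s • v₃) = -(s • (v₃ - v₁)) by module, ← hsw₁, smul_neg,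
          smul_smul, div_mul_cancel₀ _ (by positivity)]
        module
    · right
      rw [segment_eq_image']
      refine ⟨(τ - ξ) / (s * (1 - q * i)), ⟨div_nonneg (by linarith) (by positivity), ?_⟩, ?_⟩
      · rw [div_le_one (by positivity)]
        linarith [hτ.2, show s * (1 - q * i) = s - ξ by rw [hξ]; ring]
      · rw [hgr τ h]
        simp only
        rw [show x + s • v₂ - (x + s • v₃) = s • (v₂ - v₃) by module, ← hsw₂,
          smul_smul, div_mul_cancel₀ _ (by positivity)]

end

/-! ### From the curve to line derivatives of `f`. -/

section

variable {H : Type*} [NormedAddCommGroup H] [InnerProductSpace ℝ H]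

/-- Increments of `f` in direction `e` from a point `g τ` of a curve `g` with slopes close to `e`
are close to those from `x`, provided the increments of `f ∘ g` from `τ` are close to linear. -/
theorem abs_increment_sub_increment_le {f : H → ℝ} {x e : H} (he : ‖e‖ = 1) {D l q s ρ τ T : ℝ}
    (hl0 : 0 < l) (hfl : ∀ y z, |f y - f z| ≤ l * ‖y - z‖) (hq : 0 < q) (hq1 : q ≤ 1 / 96)
    (hs : 0 < s) (hsρ : s ≤ q * ρ / 8)
    (hσ : ∀ t, |t| ≤ ρ → |f (x + t • e) - f x - D * t| ≤ l * q ^ 3 * |t|) {g : ℝ → H}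
    (hg1 : ∀ t τ, ‖g t - g τ - (t - τ) • e‖ ≤ 3 * q * |t - τ|)
    (hh2 : |f (g s) - D * s - f x| ≤ 5 / 4 * (l * q ^ 3 * s))
    (hgn2 : ‖g s - x - s • e‖ ≤ q ^ 3 / 4 * s)
    (hh1 : |f (g (-s)) - D * (-s) - f x| ≤ 5 / 4 * (l * q ^ 3 * s))
    (hgn1 : ‖g (-s) - x - (-s) • e‖ ≤ q ^ 3 / 4 * s)
    (hτs : |τ| ≤ s - q ^ 2 * s) (hT2 : 2 * (l * q) ≤ T)
    (hmax : ∀ t ∈ Set.Icc (-s) s,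
      |f (g t) - D * t - (f (g τ) - D * τ)| ≤ 20 * T * |t - τ|) (t : ℝ) :
    |(f (g τ + t • e) - f (g τ)) - (f (x + t • e) - f x)| ≤ 25 * T * |t| := by
  have hT : 0 ≤ T := le_trans (by positivity) hT2
  have hq3 : q ^ 3 ≤ q / 96 / 96 := by
    have h1 := mul_le_mul_of_nonneg_left hq1 hq.le
    have h2 := mul_le_mul_of_nonneg_left hq1 (sq_nonneg q)
    linarith
  have hsρ' : s ≤ ρ / 768 := by
    have hρ : 0 < ρ := pos_of_mul_pos_right (show 0 < q * ρ by linarith) hq.le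
    have := mul_le_mul_of_nonneg_right hq1 hρ.le
    linarith
  have hτm : τ ∈ Set.Icc (-s) s := abs_le.1 (hτs.trans (sub_le_self _ (by positivity)))
  have hkT : 10 * (l * q * |t|) ≤ 5 * T * |t| := by nlinarith [abs_nonneg t]
  have hT0 : 0 ≤ 20 * T * |t| := by positivity
  have hk0 : 0 ≤ l * q * |t| := by positivity
  have hshift : ∀ p, g τ - x - τ • e =
      (g τ - g p - (τ - p) • e) + (g p - x - p • e) := fun p => by module
  -- For `|t| > ρ / 2` the Lipschitz bound suffices: `g τ` is within `2 * s` of `x`, and `s` is at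
  -- most `q * ρ / 8`.
  rcases le_or_gt |t| (ρ / 2) with htρ | htρ
  · have hψ := hσ t (by linarith)
    have hq3t : l * q ^ 3 * |t| ≤ l * q * |t| := by
      gcongr; linarith
    by_cases hin : τ + t ∈ Set.Icc (-s) s
    · have h1 := hmax _ hin
      have h0 := hg1 (τ + t) τ
      rw [show g (τ + t) - g τ - (τ + t - τ) • e = -(g τ + t • e - g (τ + t)) by module,
        norm_neg] at h0
      have h2 := (hfl (g τ + t • e) (g (τ + t))).trans (mul_le_mul_of_nonneg_left h0 hl0.le)
      rw [add_sub_cancel_left] at h1 h2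
      have h3 := abs_add_three (f (g τ + t • e) - f (g (τ + t)))
        (f (g (τ + t)) - D * (τ + t) - (f (g τ) - D * τ))
        (-(f (x + t • e) - f x - D * t))
      rw [abs_neg] at h3
      refine le_trans (le_of_eq_of_le ?_ h3) ?_
      · congr 1; ring
      · linarith
    -- When `τ + t` overshoots the curve, compare with the end point `p` on that side. As `τ` keeps
    -- distance `q ^ 2 * s` from the ends, `|t|` is at least that, so errors `l * q ^ 3 * s` are at
    -- most `l * q * |t|`.
    · obtain ⟨p, hpm, hpt, hpκ, hhp, hgp⟩ : ∃ p ∈ Set.Icc (-s) s, |p - τ| ≤ |t| ∧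
          q ^ 2 * s ≤ |t| ∧ |f (g p) - D * p - f x| ≤ 5 / 4 * (l * q ^ 3 * s) ∧
          ‖g p - x - p • e‖ ≤ q ^ 3 / 4 * s := by
        have hτ2 := abs_le.1 hτs
        rcases lt_or_ge s (τ + t) with hlt | hge
        · refine ⟨s, ⟨by linarith, le_rfl⟩, ?_, ?_, hh2, hgn2⟩
          · rw [abs_of_nonneg (by linarith [hτm.2])]
            exact le_trans (by linarith) (le_abs_self t)
          · exact le_trans (by linarith) (le_abs_self t)
        · have hlt : τ + t < -s := by
            by_contra! hc; exact hin ⟨hc, hge⟩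
          refine ⟨-s, ⟨le_rfl, by linarith⟩, ?_, ?_, hh1, hgn1⟩
          · rw [abs_of_nonpos (by linarith [hτm.1])]
            exact le_trans (by linarith) (neg_le_abs t)
          · exact le_trans (by linarith) (neg_le_abs t)
      have hB : l * q ^ 3 * s ≤ l * q * |t| := by
        have := mul_le_mul_of_nonneg_left hpκ (mul_nonneg hl0.le hq.le)
        linarith
      have h1 : ‖g τ - x - τ • e‖ ≤ 3 * q * |t| + q ^ 3 / 4 * s := by
        rw [hshift p]
        refine (norm_add_le _ _).trans (add_le_add ((hg1 τ p).trans ?_) hgp)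
        rw [abs_sub_comm]
        gcongr
      have h2 := hfl (g τ + t • e) (x + (τ + t) • e)
      rw [show g τ + t • e - (x + (τ + t) • e) = g τ - x - τ • e by module] at h2
      have h2' := mul_le_mul_of_nonneg_left h1 hl0.le
      have hτt : |τ + t| ≤ s + |t| := (abs_add_le _ _).trans (by
        have := abs_le.2 hτm; linarith)
      have h3 := hσ (τ + t) (by linarith)
      have h4 : l * q ^ 3 * |τ + t| ≤ l * q ^ 3 * (s + |t|) := by gcongr
      have h5 := hmax p hpm
      have h6 : 20 * T * |p - τ| ≤ 20 * T * |t| := by gcongr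
      have h7 := abs_add_three (f (g τ + t • e) - f (x + (τ + t) • e))
        (f (x + (τ + t) • e) - f x - D * (τ + t)) (f (g p) - D * p - (f (g τ) - D * τ))
      have h8 := abs_add_three (f (g τ + t • e) - f (x + (τ + t) • e) +
        (f (x + (τ + t) • e) - f x - D * (τ + t)) + (f (g p) - D * p - (f (g τ) - D * τ)))
        (-(f (g p) - D * p - f x))
        (-(f (x + t • e) - f x - D * t))
      rw [abs_neg, abs_neg] at h8
      refine le_trans (le_of_eq_of_le ?_ h8) ?_
      · congr 1; ring
      · linarith
  · have h1 : ‖g τ - x‖ ≤ 2 * s := by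
      have h2 := hg1 τ s
      have h3 : |τ - s| ≤ 2 * s := by
        rw [abs_of_nonpos (by linarith [hτm.2])]; linarith [hτm.1]
      have h4 : 3 * q * |τ - s| ≤ 3 * (1 / 96) * (2 * s) :=
        mul_le_mul (by linarith) h3 (abs_nonneg _) (by norm_num)
      have h5 : q ^ 3 / 4 * s ≤ 1 / 96 * s :=
        mul_le_mul_of_nonneg_right (by linarith) hs.le
      have h6 := norm_add_le ((g τ - g s - (τ - s) • e) + (g s - x - s • e)) (τ • e)
      rw [← hshift s, sub_add_cancel] at h6
      have h7 := norm_add_le (g τ - g s - (τ - s) • e) (g s - x - s • e)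
      rw [← hshift s] at h7
      rw [norm_smul, he, mul_one, Real.norm_eq_abs] at h6
      have := abs_le.2 hτm
      linarith
    have h2 := hfl (g τ + t • e) (x + t • e)
    rw [add_sub_add_right_eq_sub] at h2
    have h2' := mul_le_mul_of_nonneg_left h1 hl0.le
    have h3 := (hfl (g τ) x).trans (mul_le_mul_of_nonneg_left h1 hl0.le)
    have h4 : l * (q * (ρ / 2)) ≤ l * (q * |t|) := by gcongr
    have h5 := mul_le_mul_of_nonneg_left hsρ hl0.le
    have h6 := abs_sub (f (g τ + t • e) - f (x + t • e)) (f (g τ) - f x)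
    refine le_trans (le_of_eq_of_le ?_ h6) ?_
    · congr 1; ring
    · linarith

/-- If `f` is differentiable along a curve that is affine near `τ`, then it has the corresponding
line derivative. -/
theorem hasLineDerivAt_of_comp_eventually_affine {f : H → ℝ} {g : ℝ → H} {w : H} {D τ : ℝ}
    (h : HasDerivAt (fun t => f (g t)) D τ) (hg : ∀ᶠ t in nhds τ, g t = g τ + (t - τ) • w) :
    HasLineDerivAt ℝ f D (g τ) w := by
  have h2 : HasDerivAt (fun t => f (g τ + (t - τ) • w)) D τ :=
    h.congr_of_eventuallyEq (hg.mono fun t ht => by simp only [ht])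
  have h3 : HasDerivAt (fun t => f (g τ + (t - τ) • w)) D (0 + τ) := by rwa [zero_add]
  simpa [HasLineDerivAt] using h3.comp_add_const 0 τ

/-- Normalizing a direction of norm `N` loses at most about `3 * l * q ^ 2 ≤ d / 4` from `D` and a
tiny fraction of `d`, so half the gain `d` survives. -/
theorem add_half_le_inv_mul_add {D d l q N : ℝ} (hD0 : 0 ≤ D) (hDl : D ≤ l) (hq : 0 < q)
    (hq1 : q ≤ 1 / 96) (hd0 : 0 < d) (hd : 12 * l * q ^ 2 ≤ d) (hN0 : 0 < N)
    (hN : N ≤ 1 + 3 * q ^ 2) : D + d / 2 ≤ N⁻¹ * (d + D) := by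
  rw [inv_mul_eq_div, le_div_iff₀ hN0]
  have h1 : (D + d / 2) * N ≤ (D + d / 2) * (1 + 3 * q ^ 2) := by gcongr
  have h2 : D * q ^ 2 ≤ l * q ^ 2 := by gcongr
  have h3 : d * q ^ 2 ≤ d * (1 / 96) :=
    mul_le_mul_of_nonneg_left (by nlinarith) hd0.le
  linarith

/-- Since `d ≤ 2 * G`, the first constant needed is `8 * √6 < 20`; the second bound holds because `G
≥ 6 * l * q ^ 2`. -/
theorem sqrt_gain_bounds {G d l q : ℝ} (hl : 0 < l) (hq : 0 < q) (hd : 12 * l * q ^ 2 ≤ d)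
    (hG : d / 2 ≤ G) :
    8 * √(d * (3 * l)) ≤ 20 * √(G * l) ∧ 2 * (l * q) ≤ √(G * l) := by
  have h1 : d / 2 * l ≤ G * l := mul_le_mul_of_nonneg_right hG hl.le
  have h2 : 12 * l * q ^ 2 * l ≤ d * l := mul_le_mul_of_nonneg_right hd hl.le
  have h3 : 0 < l * q ^ 2 * l := by positivity
  constructor
  · rw [← abs_of_pos (show (0 : ℝ) < 8 by norm_num),
      ← abs_of_pos (show (0 : ℝ) < 20 by norm_num), ← Real.sqrt_sq_eq_abs, ← Real.sqrt_sq_eq_abs,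
      ← Real.sqrt_mul (by positivity), ← Real.sqrt_mul (by positivity)]
    apply Real.sqrt_le_sqrt
    linarith
  · apply Real.le_sqrt_of_sq_le
    linarith

/-- If the increment of `f` at `x` in a direction `u` deviates from `D * ⟪u, e⟫`, then on the broken
line from near `x - s • e` to near `x + s • e` through near `x + (q * s) • u` there is a point at
which `f` has a line derivative exceeding `D`, with controlled increments in direction `e`. -/
theorem LipschitzWith.exists_hasLineDerivAt_ge_of_deviation {f : H → ℝ} {L : ℝ≥0}
    (hf : LipschitzWith L f) (hL : 0 < L) {x e u v₁ v₂ v₃ : H} (he : ‖e‖ = 1) (hu : ‖u‖ = 1)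
    {D q s ρ : ℝ} (hD0 : 0 ≤ D) (hDL : D ≤ L) (hq : 0 < q) (hq1 : q ≤ 1 / 96) (hs : 0 < s)
    (hsρ : s ≤ q * ρ / 8) (hσ : ∀ t, |t| ≤ ρ → |f (x + t • e) - f x - D * t| ≤ L * q ^ 3 * |t|)
    (hv₁ : ‖v₁ - -e‖ ≤ q ^ 3 / 4) (hv₂ : ‖v₂ - e‖ ≤ q ^ 3 / 4) (hv₃ : ‖v₃ - q • u‖ ≤ q ^ 3 / 4)
    (hdev : 96 * L * q * (q * s) < |f (x + (q * s) • u) - f x - D * ((q * s) * ⟪u, e⟫)|) :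
    ∃ x' ∈ segment ℝ (x + s • v₁) (x + s • v₃) ∪ segment ℝ (x + s • v₃) (x + s • v₂),
      ∃ e' : H, ‖e'‖ = 1 ∧ ∃ D', HasLineDerivAt ℝ f D' x' e' ∧ D + 6 * L * q ^ 2 ≤ D' ∧
        ∀ t : ℝ, |(f (x' + t • e) - f x') - (f (x + t • e) - f x)| ≤
          25 * √((D' - D) * L) * |t| := by
  obtain ⟨l, hl⟩ : ∃ l : ℝ, (L : ℝ) = l := ⟨_, rfl⟩
  have hl0 : 0 < l := hl ▸ hL
  have hfl : ∀ y z, |f y - f z| ≤ l * ‖y - z‖ := fun y z => by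
    simpa [Real.dist_eq, dist_eq_norm, hl] using hf.dist_le_mul y z
  have hq2 : q ^ 2 ≤ q / 96 := by
    have := mul_le_mul_of_nonneg_left hq1 hq.le
    linarith
  have hq3 : q ^ 3 ≤ q ^ 2 / 96 := by
    have := mul_le_mul_of_nonneg_left hq1 (sq_nonneg q)
    linarith
  have hq3' : q ^ 3 / 4 ≤ q ^ 2 / 4 := by linarith [sq_nonneg q]
  have hρ : 0 < ρ := pos_of_mul_pos_right (show 0 < q * ρ by linarith) hq.le
  obtain ⟨g, hg1, hg2, hg3, hgs, hgξ, hgs', hgseg⟩ := exists_brokenLine (x := x) he hu hq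
    (by linarith) hs (hv₁.trans hq3') (hv₂.trans hq3') (hv₃.trans hq3')
  set ξ := s * (q * ⟪u, e⟫) with hξ
  set h : ℝ → ℝ := fun t => f (g t) - D * t with hh
  have hsρ' : s ≤ ρ / 768 := by
    have := mul_le_mul_of_nonneg_right hq1 hρ.le
    linarith
  have hA0 : 0 < l * q ^ 2 * s := by positivity
  have hBA : l * q ^ 3 * s ≤ l * q ^ 2 * s / 96 := by
    have := mul_le_mul_of_nonneg_left hq3 (mul_nonneg hl0.le hs.le)
    linarith
  have hend : ∀ p, g p - x - p • e = s • (v₂ - e) ∨ g p - x - p • e = s • (v₁ - -e) →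
      |p| = s → |h p - f x| ≤ 5 / 4 * (l * q ^ 3 * s) ∧ ‖g p - x - p • e‖ ≤ q ^ 3 / 4 * s := by
    intro p hp hps
    have h1 : ‖g p - x - p • e‖ ≤ q ^ 3 / 4 * s := by
      rcases hp with hp | hp <;> rw [hp, norm_smul, Real.norm_of_nonneg hs.le, mul_comm]
      exacts [mul_le_mul_of_nonneg_right hv₂ hs.le, mul_le_mul_of_nonneg_right hv₁ hs.le]
    refine ⟨?_, h1⟩
    have h2 := hσ p (by rw [hps]; linarith)
    have h3 := hfl (g p) (x + p • e)
    rw [← sub_sub] at h3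
    have h4 := mul_le_mul_of_nonneg_left h1 hl0.le
    rw [hl, hps] at h2
    have h5 := abs_add_le (f (g p) - f (x + p • e)) (f (x + p • e) - f x - D * p)
    rw [show f (g p) - f (x + p • e) + (f (x + p • e) - f x - D * p) = h p - f x by
      simp only [hh]; ring] at h5
    linarith
  obtain ⟨hh2, hgn2⟩ := hend s (Or.inl (by rw [hgs']; module)) (abs_of_pos hs)
  obtain ⟨hh1, hgn1⟩ := hend (-s) (Or.inr (by rw [hgs]; module))
    (by rw [abs_neg, abs_of_pos hs])
  have hhξ : 96 * (l * q ^ 2 * s) - l * q ^ 3 * s / 4 ≤ |h ξ - f x| := by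
    have h1 := hfl (x + (q * s) • u) (x + s • v₃)
    rw [show x + (q * s) • u - (x + s • v₃) = -(s • (v₃ - q • u)) by module, norm_neg, norm_smul,
      Real.norm_of_nonneg hs.le] at h1
    have h2 : l * (s * ‖v₃ - q • u‖) ≤ l * (s * (q ^ 3 / 4)) := by gcongr
    have h3 := abs_add_le (f (x + (q * s) • u) - f (x + s • v₃)) (h ξ - f x)
    rw [show f (x + (q * s) • u) - f (x + s • v₃) + (h ξ - f x) =
      f (x + (q * s) • u) - f x - D * ((q * s) * ⟪u, e⟫) by
        simp only [hh, hgξ]; rw [hξ]; ring] at h3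
    rw [hl] at hdev
    linarith
  have hLip : LipschitzWith (3 * L) h := by
    refine LipschitzWith.of_dist_le_mul fun t τ => ?_
    rw [Real.dist_eq, Real.dist_eq]
    push_cast
    have h1 := (hfl (g t) (g τ)).trans (mul_le_mul_of_nonneg_left (hg2 t τ) hl0.le)
    have h2 := abs_sub (f (g t) - f (g τ)) (D * (t - τ))
    rw [abs_mul, abs_of_nonneg hD0] at h2
    rw [show h t - h τ = f (g t) - f (g τ) - D * (t - τ) by simp only [hh]; ring]
    have h3 : D * |t - τ| ≤ l * |t - τ| := mul_le_mul_of_nonneg_right (hl ▸ hDL) (abs_nonneg _)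
    have h4 : l * ((1 + 3 * q ^ 2) * |t - τ|) ≤ l * (2 * |t - τ|) := by
      gcongr; linarith
    rw [hl]
    linarith
  have hξm : ξ ∈ Set.Icc (-s) s := by
    have hi1 : |⟪u, e⟫| ≤ 1 := by simpa [he, hu] using abs_real_inner_le_norm u e
    have h1 : |q * ⟪u, e⟫| ≤ 1 := by
      rw [abs_mul, abs_of_pos hq]
      exact mul_le_one₀ (by linarith) (abs_nonneg _) hi1
    refine abs_le.1 ?_
    rw [hξ, abs_mul, abs_of_pos hs]
    exact mul_le_of_le_one_right hs.le h1
  -- With `M = 3 * L`, the terms in `c` and `κ` cost `24 + 6` units of `L * q ^ 2 * s`, while the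
  -- detour to the kink yields about `2 * 96 / 4 = 48`; the end errors are smaller by a factor `q`.
  obtain ⟨τ, hτ, hτξ, hdiff, hd, hmax⟩ := hLip.exists_deriv_ge_forall_abs_sub_le
    (c := 12 * l * q ^ 2) (κ := q ^ 2) (by positivity) hs hξm (by positivity) (by positivity)
    (by linarith) (by
      push_cast
      rw [hl]
      have h1 := abs_sub (h s - f x) (h (-s) - f x)
      have h2 := abs_sub (h ξ - h (-s)) (-(h (-s) - f x))
      have h3 := abs_sub (h s - f x) (h s - h ξ)
      rw [sub_sub_sub_cancel_right] at h1
      rw [abs_neg, sub_neg_eq_add, sub_add_sub_cancel] at h2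
      rw [sub_sub_sub_cancel_left] at h3
      linarith)
  have hτs : |τ| ≤ s - q ^ 2 * s := by linarith
  have hτm : τ ∈ Set.Icc (-s) s := abs_le.1 (hτs.trans (sub_le_self _ (by positivity)))
  obtain ⟨w, hwe, hw, hgw⟩ := hg3 τ hτξ
  set d := deriv h τ with hd'
  have hd0 : 0 < d := lt_of_lt_of_le (by positivity) hd
  have hd3 : d ≤ 3 * l := by
    have := norm_deriv_le_of_lipschitz (x₀ := τ) hLip
    push_cast at this
    rw [hl] at this
    exact (le_abs_self _).trans this
  have hN0 : 0 < ‖w‖ := by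
    have := norm_sub_norm_le e (e - w)
    rw [sub_sub_cancel, he, norm_sub_rev] at this
    linarith
  have hline : HasLineDerivAt ℝ f (d + D) (g τ) w := by
    have h1 : HasDerivAt (fun t => f (g t)) (d + D) τ := by
      have h2 := hdiff.hasDerivAt.add ((hasDerivAt_id τ).const_mul D)
      rw [mul_one] at h2
      refine h2.congr_of_eventuallyEq (Filter.Eventually.of_forall fun t => ?_)
      simp [hh]
    exact hasLineDerivAt_of_comp_eventually_affine h1 hgw
  have hline' := hline.smul ‖w‖⁻¹
  rw [smul_eq_mul] at hline'
  have hgain : D + d / 2 ≤ ‖w‖⁻¹ * (d + D) :=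
    add_half_le_inv_mul_add hD0 (hl ▸ hDL) hq hq1 hd0 hd hN0 hw
  set D' := ‖w‖⁻¹ * (d + D) with hD'
  refine ⟨g τ, hgseg τ hτm, ‖w‖⁻¹ • w, ?_, D', hline', by rw [hl]; linarith, ?_⟩
  · rw [norm_smul, norm_inv, norm_norm, inv_mul_cancel₀ hN0.ne']
  rw [hl]
  obtain ⟨hT1, hT2⟩ := sqrt_gain_bounds (G := D' - D) hl0 hq hd (by linarith)
  push_cast at hmax
  rw [hl] at hmax
  have hmax' : ∀ t ∈ Set.Icc (-s) s, |h t - h τ| ≤ 20 * √((D' - D) * l) * |t - τ| := fun t ht =>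
    (hmax t ht).trans (mul_le_mul_of_nonneg_right hT1 (abs_nonneg _))
  exact abs_increment_sub_increment_le he hl0 hfl hq hq1 hs hsρ (hl ▸ hσ) hg1 hh2 hgn2 hh1 hgn1 hτs
    hT2 hmax'

end

/-! ### Fréchet differentiability. -/

theorem mainTheorem4 {H : Type*} [NormedAddCommGroup H] [InnerProductSpace ℝ H]
    [CompleteSpace H] (f : H → ℝ) (hf : ∃ K : ℝ≥0, LipschitzWith K f)
    (x e : H) (he : ‖e‖ = 1)
    (D : ℝ) (hD : HasLineDerivAt ℝ f D x e) (hD0 : 0 ≤ D)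
    (F : ℝ → Set H)
    (hF1 : ∀ ε : ℝ, 0 < ε → ∀ η : ℝ, 0 < η → ∃ δ₀ : ℝ, 0 < δ₀ ∧
      ∀ δ : ℝ, 0 < δ → δ < δ₀ →
      ∀ u₁ u₂ u₃ : H, ‖u₁‖ ≤ 1 → ‖u₂‖ ≤ 1 → ‖u₃‖ ≤ 1 →
      ∃ v₁ v₂ v₃ : H, ‖v₁ - u₁‖ ≤ η ∧ ‖v₂ - u₂‖ ≤ η ∧ ‖v₃ - u₃‖ ≤ η ∧
        segment ℝ (x + δ • v₁) (x + δ • v₃) ∪ segment ℝ (x + δ • v₃) (x + δ • v₂) ⊆ F ε)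
    (hF2 : ∀ ε : ℝ, 0 < ε → ∀ x' ∈ F ε, ∀ e' : H, ‖e'‖ = 1 →
      ∀ D' : ℝ, HasLineDerivAt ℝ f D' x' e' → D ≤ D' →
      (∀ t : ℝ, |(f (x' + t • e) - f x') - (f (x + t • e) - f x)| ≤
        25 * √((D' - D) * (lipConst f : ℝ)) * |t|) →
      D' < D + ε) :
    ∃ f' : H →L[ℝ] ℝ, HasFDerivAt f f' x ∧ ∀ h : H, f' h = D * ⟪h, e⟫ := by
  refine ⟨D • innerSL ℝ e, ?_, fun h => by simp [real_inner_comm]⟩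
  have hL : LipschitzWith (lipConst f) f := (isLeast_lipConst hf).1
  have hDL : D ≤ lipConst f := by
    have := hD.le_of_lipschitz hL
    rw [he, mul_one, Real.norm_eq_abs] at this
    exact (le_abs_self D).trans this
  generalize lipConst f = L at hF2 hL hDL
  rcases eq_or_lt_of_le (show 0 ≤ L from zero_le) with rfl | hL0
  · have hD' : D = 0 := le_antisymm (by simpa using hDL) hD0
    have hconst : f = fun _ => f x := funext fun y => by
      simpa using hL.dist_le_mul y x
    rw [hD', zero_smul, hconst]
    exact hasFDerivAt_const _ _
  have hl0 : (0 : ℝ) < L := hL0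
  rw [hasFDerivAt_iff_isLittleO_nhds_zero, Asymptotics.isLittleO_iff]
  intro ω hω
  set q : ℝ := min (1 / 96) (ω / (96 * L)) with hq
  have hq0 : 0 < q := by positivity
  have hqω : 96 * L * q ≤ ω := by
    have := min_le_right (1 / 96) (ω / (96 * (L : ℝ)))
    rw [← hq, le_div_iff₀ (by positivity)] at this
    linarith
  obtain ⟨ρ, hρ, hσ⟩ : ∃ ρ > 0, ∀ t, |t| ≤ ρ →
      |f (x + t • e) - f x - D * t| ≤ L * q ^ 3 * |t| := by
    have h1 := (hasDerivAt_iff_isLittleO_nhds_zero.1 hD).def (show 0 < L * q ^ 3 by positivity)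
    obtain ⟨ρ, hρ, hb⟩ := Metric.eventually_nhds_iff.1 h1
    refine ⟨ρ / 2, by positivity, fun t ht => ?_⟩
    have := @hb t (by rw [dist_zero_right, Real.norm_eq_abs]; linarith)
    simpa [mul_comm] using this
  -- `ε` is exactly the guaranteed gain in the derivative, and `η` makes the vertex errors of order
  -- `q ^ 3`, below the gain.
  obtain ⟨δ₀, hδ₀, hδ⟩ := hF1 (6 * L * q ^ 2) (by positivity) (q ^ 3 / 4) (by positivity)
  have hr0 : 0 < q * min δ₀ (q * ρ / 8) := by positivity
  filter_upwards [Metric.ball_mem_nhds (0 : H) hr0] with y hy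
  rw [mem_ball_zero_iff] at hy
  rcases eq_or_ne y 0 with rfl | hy0
  · simp
  have hyn : 0 < ‖y‖ := norm_pos_iff.2 hy0
  by_contra! hcon
  set u : H := ‖y‖⁻¹ • y with hu
  -- With this scale `y = s • (q • u)`, so the kink is near `x + y`.
  set s : ℝ := ‖y‖ / q with hs
  have hs0 : 0 < s := by positivity
  have hqs : q * s = ‖y‖ := by rw [hs]; field_simp
  have hsm : s < min δ₀ (q * ρ / 8) := by rw [hs, div_lt_iff₀ hq0]; linarith
  have hun : ‖u‖ = 1 := by rw [hu, norm_smul, norm_inv, norm_norm, inv_mul_cancel₀ hyn.ne']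
  have hyu : (q * s) • u = y := by rw [hqs, hu, smul_smul, mul_inv_cancel₀ hyn.ne', one_smul]
  obtain ⟨v₁, v₂, v₃, h1, h2, h3, hseg⟩ := hδ s hs0 (hsm.trans_le (min_le_left _ _)) (-e) e (q • u)
    (by rw [norm_neg, he]) he.le (by
      rw [norm_smul, hun, mul_one, Real.norm_of_nonneg hq0.le]
      exact (min_le_left _ _).trans (by norm_num))
  obtain ⟨x', hx', e', he', D', hD', hge, hbd⟩ := hL.exists_hasLineDerivAt_ge_of_deviation hL0 he
    hun hD0 hDL hq0 (min_le_left _ _) hs0 (hsm.le.trans (min_le_right _ _)) hσ h1 h2 h3 (by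
      rw [← real_inner_smul_left, hyu, hqs]
      refine lt_of_le_of_lt (mul_le_mul_of_nonneg_right hqω hyn.le) (hcon.trans_eq ?_)
      simp [real_inner_comm])
  have hpos : 0 < 6 * L * q ^ 2 := by positivity
  exact absurd (hF2 _ hpos x' (hseg hx') e' he' D' hD' (by linarith) hbd) (not_lt.2 hge)
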